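/- All graphs are finite and simple. For a graph $X$ let $L_X=D_X-A_X$ be its Laplacian matrix. For vertices $x\neq y$ of $X$, *Laplacian perfect state transfer* (LPST) occurs between $x$ and $y$ if $|\exp(-\mathrm{i}\tau L_X)_{x,y}|=1$ for some $\tau\in\mathbb{R}$; *Laplacian pretty good state transfer* (LPGST) occurs between $x$ and $y$ if for every $\varepsilon>0$ there is $t\in\mathbb{R}$ with $|\exp(-\mathrm{i}tL_X)_{x,y}|\ge 1-\varepsilon$. The *Laplacian eigenvalue support* of $x$ is the set $\mathrm{supp}_{L_X}(x)$ of all eigenvalues $\lambda$ of $L_X$ with $F_\lambda\mathbf{e}_x\neq\mathbf{0}$, where $F_\lambda$ is the orthogonal projection onto the $\lambda$-eigenspace of $L_X$ and $\mathbf{e}_x$ is the characteristic vector of $x$. For a graph $G$ with vertex set $\{v_1,\dots,v_n\}$ and an $n$-tuple $\overrightarrow{H}=(H_1,\dots,H_n)$ of graphs, the *vertex complemented corona* $G\tilde{\circ}\overrightarrow{H}$ is obtained from the disjoint union of $G$ and $H_1,\dots,H_n$ by joining every vertex of $H_i$ to every vertex of $V(G)\setminus\{v_i\}$, for $i=1,\dots,n$.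 A vertex $v$ of $G$, regarded as a vertex of $G\tilde{\circ}\overrightarrow{H}$, is denoted $(v,0)$. **Theorem.** Let $G$ be a connected graph with $n$ vertices and let $\overrightarrow{H}=(H_1,\dots,H_n)$ be an $n$-tuple of graphs with $|V(H_i)|=k\ge 1$ for $i=1,\dots,n$. Suppose that $G$ has LPST between vertices $u$ and $v$. Then there is a greatest integer $e\ge 0$ such that every element of $\mathrm{supp}_{L_G}(u)$ is an integer divisible by $2^e$; and if, for this $e$, $2^{e+1}$ divides $(n-1)(1+k)$, then $G\tilde{\circ}\overrightarrow{H}$ has LPGST between $(u,0)$ and $(v,0)$. -/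

import Mathlib

/-- The Laplacian transition matrix `exp(-i t L_G)`, where `L_G = D_G - A_G`. -/
noncomputable def lapTransition {V : Type*} [Fintype V] (G : SimpleGraph V) (t : ℝ) :
    Matrix V V ℂ := by
  classical
  exact NormedSpace.exp ((-(Complex.I * (t : ℂ))) • G.lapMatrix ℂ)

/-- Laplacian perfect state transfer from `u` to `v`, at some real time. -/
def HasLPST {V : Type*} [Fintype V] (G : SimpleGraph V) (u v : V) : Prop :=
  u ≠ v ∧ ∃ τ : ℝ, ‖lapTransition G τ u v‖ = 1

/-- Laplacian pretty good state transfer from `u` to `v`. -/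
def HasLPGST {V : Type*} [Fintype V] (G : SimpleGraph V) (u v : V) : Prop :=
  ∀ ε : ℝ, 0 < ε → ∃ t : ℝ, 1 - ε ≤ ‖lapTransition G t u v‖

/-- The Laplacian of `G` as a linear operator on the Euclidean space `ℝ^V`. -/
noncomputable def lapOperator {V : Type*} [Fintype V] (G : SimpleGraph V) :
    Module.End ℝ (EuclideanSpace ℝ V) := by
  classical
  exact Matrix.toEuclideanLin (G.lapMatrix ℝ)

/-- The eigenprojector `F_μ` of `G`: the orthogonal projection of `ℝ^V` onto the eigenspace of the
Laplacian for `μ`. -/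
noncomputable def lapEigenprojector {V : Type*} [Fintype V] (G : SimpleGraph V) (μ : ℝ) :
    EuclideanSpace ℝ V →L[ℝ] EuclideanSpace ℝ V :=
  (Module.End.eigenspace (lapOperator G) μ).starProjection

open Classical in
/-- The Laplacian eigenvalue support of `u`: the eigenvalues `μ` of `L_G` with `F_μ e_u ≠ 0`. -/
def lapSupport {V : Type*} [Fintype V] (G : SimpleGraph V) (u : V) : Set ℝ :=
  {μ | Module.End.HasEigenvalue (lapOperator G) μ ∧
    lapEigenprojector G μ (EuclideanSpace.single u (1 : ℝ)) ≠ 0}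

/-- Adjacency in the vertex complemented corona. The vertex `(v, 0)` is `Sum.inl v`; the vertex
`(v, w)` with `w` a vertex of the graph `H v` attached to `v` is `Sum.inr ⟨v, w⟩`. -/
inductive VCCAdj {V : Type*} {W : V → Type*} (G : SimpleGraph V) (H : ∀ v, SimpleGraph (W v)) :
    (V ⊕ (Σ v, W v)) → (V ⊕ (Σ v, W v)) → Prop
  | base (a b : V) : G.Adj a b → VCCAdj G H (Sum.inl a) (Sum.inl b)
  | copy (a : V) (w w' : W a) : (H a).Adj w w' → VCCAdj G H (Sum.inr ⟨a, w⟩) (Sum.inr ⟨a, w'⟩)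
  | joinLeft (a b : V) (w : W b) : a ≠ b → VCCAdj G H (Sum.inl a) (Sum.inr ⟨b, w⟩)
  | joinRight (a b : V) (w : W b) : a ≠ b → VCCAdj G H (Sum.inr ⟨b, w⟩) (Sum.inl a)

/-- The vertex complemented corona of `G` and the family `H` of graphs indexed by the vertices of
`G`: the disjoint union of `G` and all `H v`, with every vertex of `H v` joined to every vertex of
`G` other than `v`. -/
def vertexComplementedCorona {V : Type*} {W : V → Type*} (G : SimpleGraph V)
    (H : ∀ v, SimpleGraph (W v)) : SimpleGraph (V ⊕ (Σ v, W v)) where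
  Adj := VCCAdj G H
  symm := ⟨by
    intro x y h
    cases h with
    | base a b h => exact VCCAdj.base b a h.symm
    | copy a w w' h => exact VCCAdj.copy a w' w h.symm
    | joinLeft a b w h => exact VCCAdj.joinRight a b w h
    | joinRight a b w h => exact VCCAdj.joinLeft a b w h⟩
  loopless := ⟨by
    intro x h
    rcases x with a | ⟨a, w⟩
    · cases h with
      | base _ _ h => exact G.loopless.irrefl a h
    · cases h with
      | copy _ _ _ h => exact (H a).loopless.irrefl w h⟩

/-- `2 ^ m` divides every element of the set `S` of real numbers, in the integers: each element of
`S` is an integer multiple of `2 ^ m`. -/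
def TwoPowDividesAll (S : Set ℝ) (m : ℕ) : Prop :=
  ∀ μ ∈ S, ∃ z : ℤ, μ = 2 ^ m * (z : ℝ)

/-!
Let `n = |V|`, let `B` be an orthonormal eigenbasis of the Laplacian `L` of `G`, and write `s` for
the eigenvalue of a basis vector `f`.

*The support.* Perfect state transfer at time `τ` is an equality case of the Cauchy-Schwarz
inequality, and says `exp (-i τ s) f(u) = f(v)` for every `f`
(`LapEigenbasis.exp_mul_vec_eq_of_norm_eq_one`; there is no global phase since `L` kills the
all-ones vector). Hence `τ s = π z` with `z` an integer whenever `s` lies in the support of `u`,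
with some `z` odd. The sum of the support is rational (`LapEigenbasis.exists_rat_sum_support`), the
ratios of its nonzero members are rational and none is negative, so all of them are rational, and
then integers (`LapEigenbasis.exists_int_of_commensurable`). With `2 ^ e` the greatest power of `2`
dividing them all, `z` has the parity of `s / 2 ^ e` (`LapEigenbasis.even_sub_of_isGreatest`).

*The corona.* The vectors `(p f, q f ⊗ 1)` span a subspace invariant under the Laplacian of the
corona, which acts on it by a two by two matrix whose eigenvalues have sum `s + (n - 1) (1 + k)`
and difference `δ`, the `coronaGap`. So the transition matrix at time `t`, compressed to `V`,
multiplies `f` by `exp (-i t (s + (n - 1) (1 + k)) / 2)` times a convex combination of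
`exp (± i t δ / 2)` (`lapTransition_corona_sum`). At `t = 2 π j / 2 ^ e` with `j` odd, the
divisibility hypothesis makes the first factor equal to `exp (-i τ s)`, and the amplitude is close
to `1` as soon as each `j δ / 2 ^ (e + 1)` is close to an integer.

*The choice of `j`.* By a form of Kronecker's theorem (`exists_odd_mul_near_int`) the only
obstruction to finding an odd `j` is an integer combination of the `δ / 2 ^ (e + 1)` lying in
`1/2 + ℤ`. For `s > 0` the radicand `δ ^ 2 = (s + (n - 1) (k - 1)) ^ 2 + 4 k` is not a square, so
`δ` has trace zero over `ℚ`, and a rational integer combination of such numbers vanishes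
(`sum_sqrt_eq_zero_of_rational`). For `s = 0` the gap is `(n - 1) (1 + k)`, a multiple of
`2 ^ (e + 1)`.
-/

/-! ### Odd multiples of a point of the torus -/

/-- The point `(j α₁, …, j α_d)` of the torus `(ℝ/ℤ)^d`. -/
noncomputable def torusMultiple {ι : Type*} (α : ι → ℝ) (j : ℤ) : UnitAddTorus ι :=
  fun i => ((j * α i : ℝ) : UnitAddCircle)

theorem mFourier_torusMultiple {ι : Type*} [Fintype ι] (α : ι → ℝ) (c : ι → ℤ) (j : ℕ) :
    UnitAddTorus.mFourier c (torusMultiple α j) =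
      Complex.exp (2 * Real.pi * Complex.I * (∑ i, c i * α i : ℝ)) ^ j := by
  simp only [UnitAddTorus.mFourier, torusMultiple, ContinuousMap.coe_mk, fourier_coe_apply,
    ← Complex.exp_nat_mul, ← Complex.exp_sum]
  congr 1
  push_cast
  simp only [Finset.mul_sum]
  refine Finset.sum_congr rfl fun i _ => ?_
  ring

theorem exp_two_pi_eq_neg_one {x : ℝ} (h : Complex.exp (2 * Real.pi * Complex.I * x) = -1) :
    ∃ m : ℤ, x = m + 1 / 2 := by
  rw [← Complex.exp_pi_mul_I, Complex.exp_eq_exp_iff_exists_int] at h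
  obtain ⟨m, hm⟩ := h
  refine ⟨m, ?_⟩
  have h2 : (2 * Real.pi * Complex.I : ℂ) ≠ 0 := Complex.two_pi_I_ne_zero
  have : (x : ℂ) = m + 1 / 2 := by
    apply mul_left_cancel₀ h2
    linear_combination hm
  have h3 : (x : ℂ) = ((m + 1 / 2 : ℝ) : ℂ) := by push_cast; exact this
  exact_mod_cast h3

/-- Alternating sums of a trigonometric polynomial along the multiples of a point stay bounded,
as long as no character takes the value `-1` at that point: they are combinations of geometric
series of ratio different from `1`. -/
theorem exists_bound_alternating_sum {ι : Type*} [Fintype ι] (α : ι → ℝ)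
    (hα : ∀ (c : ι → ℤ) (m : ℤ), ∑ i, c i * α i ≠ m + 1 / 2)
    (Q : C(UnitAddTorus ι, ℂ))
    (hQ : Q ∈ Submodule.span ℂ (Set.range (UnitAddTorus.mFourier (d := ι)))) :
    ∃ C : ℝ, ∀ N : ℕ, ‖∑ j ∈ Finset.range N, (-1 : ℂ) ^ j * Q (torusMultiple α j)‖ ≤ C := by
  induction hQ using Submodule.span_induction with
  | mem Q h =>
    obtain ⟨c, rfl⟩ := h
    set z : ℂ := Complex.exp (2 * Real.pi * Complex.I * (∑ i, c i * α i : ℝ)) with hz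
    have hz1 : -z ≠ 1 := by
      intro h
      obtain ⟨m, hm⟩ := exp_two_pi_eq_neg_one (x := ∑ i, c i * α i) (by rw [← hz, ← h, neg_neg])
      exact hα c m hm
    have hzn : ‖-z‖ = 1 := by
      rw [norm_neg, hz, Complex.norm_exp]
      simp
    refine ⟨2 / ‖-z - 1‖, fun N => ?_⟩
    have : ∑ j ∈ Finset.range N, (-1 : ℂ) ^ j * UnitAddTorus.mFourier c (torusMultiple α j)
        = ∑ j ∈ Finset.range N, (-z) ^ j := by
      refine Finset.sum_congr rfl fun j _ => ?_
      rw [mFourier_torusMultiple, ← mul_pow, neg_one_mul]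
    rw [this, geom_sum_eq hz1, norm_div]
    gcongr
    calc ‖(-z) ^ N - 1‖ ≤ ‖(-z) ^ N‖ + ‖(1 : ℂ)‖ := norm_sub_le _ _
      _ = 2 := by rw [norm_pow, hzn, norm_one, one_pow]; norm_num
  | zero => exact ⟨0, fun N => by simp⟩
  | add P Q _ _ hP hQ =>
    obtain ⟨C, hC⟩ := hP
    obtain ⟨D, hD⟩ := hQ
    refine ⟨C + D, fun N => ?_⟩
    simp only [ContinuousMap.add_apply, mul_add, Finset.sum_add_distrib]
    exact (norm_add_le _ _).trans (add_le_add (hC N) (hD N))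
  | smul a Q _ hQ =>
    obtain ⟨C, hC⟩ := hQ
    refine ⟨‖a‖ * C, fun N => ?_⟩
    simp only [ContinuousMap.smul_apply, smul_eq_mul, mul_left_comm _ a, ← Finset.mul_sum, norm_mul]
    exact mul_le_mul_of_nonneg_left (hC N) (norm_nonneg _)

/-- The closures of the even and of the odd multiples of a point of the torus meet, unless some
character takes the value `-1` at that point. A continuous function separating them would have
alternating sums growing linearly. -/
theorem not_disjoint_closure_even_odd {ι : Type*} [Fintype ι] (α : ι → ℝ)
    (hα : ∀ (c : ι → ℤ) (m : ℤ), ∑ i, c i * α i ≠ m + 1 / 2) :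
    ¬ Disjoint (closure (Set.range fun l : ℤ => torusMultiple α (2 * l)))
      (closure (Set.range fun l : ℤ => torusMultiple α (2 * l + 1))) := by
  intro hd
  obtain ⟨F, hF0, hF1, -⟩ := exists_continuous_zero_one_of_isClosed isClosed_closure
    isClosed_closure hd
  let F' : C(UnitAddTorus ι, ℂ) := ⟨fun x => (F x : ℂ), by fun_prop⟩
  have hF' : F' ∈ closure
      (Submodule.span ℂ (Set.range (UnitAddTorus.mFourier (d := ι))) : Set _) := by
    have := UnitAddTorus.span_mFourier_closure_eq_top (d := ι)
    rw [← Submodule.topologicalClosure_coe, this]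
    trivial
  obtain ⟨Q, hQ, hFQ⟩ := Metric.mem_closure_iff.1 hF' (1 / 4) (by norm_num)
  obtain ⟨C, hC⟩ := exists_bound_alternating_sum α hα Q hQ
  have hsum (N : ℕ) :
      ∑ j ∈ Finset.range (2 * N), (-1 : ℂ) ^ j * F' (torusMultiple α j) = -N := by
    induction N with
    | zero => simp
    | succ N ih =>
      have h0 : F (torusMultiple α ((2 * N : ℕ) : ℤ)) = 0 :=
        hF0 (subset_closure ⟨N, by push_cast; rfl⟩)
      have h1 : F (torusMultiple α ((2 * N + 1 : ℕ) : ℤ)) = 1 :=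
        hF1 (subset_closure ⟨N, by push_cast; rfl⟩)
      have h0' : F' (torusMultiple α ((2 * N : ℕ) : ℤ)) = 0 := by
        simp only [F', ContinuousMap.coe_mk, h0, Complex.ofReal_zero]
      have h1' : F' (torusMultiple α ((2 * N + 1 : ℕ) : ℤ)) = 1 := by
        simp only [F', ContinuousMap.coe_mk, h1, Complex.ofReal_one]
      rw [show 2 * (N + 1) = 2 * N + 1 + 1 by ring, Finset.sum_range_succ, Finset.sum_range_succ,
        ih, h0', h1', pow_succ, pow_mul]
      push_cast
      simp
      ring
  have hdist (x) : ‖F' x - Q x‖ ≤ 1 / 4 := by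
    rw [← dist_eq_norm]
    exact (ContinuousMap.dist_apply_le_dist x).trans hFQ.le
  obtain ⟨N, hN⟩ := exists_nat_gt (2 * C)
  have hb : ‖∑ j ∈ Finset.range (2 * N), ((-1 : ℂ) ^ j * F' (torusMultiple α j)
      - (-1 : ℂ) ^ j * Q (torusMultiple α j))‖ ≤ 2 * N * (1 / 4) := by
    refine (norm_sum_le _ _).trans ?_
    refine (Finset.sum_le_card_nsmul _ _ (1 / 4) fun j _ => ?_).trans ?_
    · rw [← mul_sub, norm_mul, norm_pow, norm_neg, norm_one, one_pow, one_mul]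
      exact hdist _
    · simp
  rw [Finset.sum_sub_distrib, hsum] at hb
  have h3 := hC (2 * N)
  have h4 := norm_sub_norm_le (-(N : ℂ))
    (∑ j ∈ Finset.range (2 * N), (-1 : ℂ) ^ j * Q (torusMultiple α j))
  rw [norm_neg, Complex.norm_natCast] at h4
  linarith

/-- A form of Kronecker's theorem: if no integer combination of the `α i` lies in `1/2 + ℤ`, then
some odd multiple of `α` is arbitrarily close to an integer point. -/
theorem exists_odd_mul_near_int {ι : Type*} [Fintype ι] (α : ι → ℝ)
    (hα : ∀ (c : ι → ℤ) (m : ℤ), ∑ i, c i * α i ≠ m + 1 / 2) (ε : ℝ) (hε : 0 < ε) :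
    ∃ l : ℤ, ∀ i, ∃ n : ℤ, |(2 * l + 1) * α i - n| < ε := by
  obtain ⟨x, hx0, hx1⟩ := Set.not_disjoint_iff.1 (not_disjoint_closure_even_odd α hα)
  obtain ⟨_, ⟨l0, rfl⟩, h0⟩ := Metric.mem_closure_iff.1 hx0 (ε / 2) (by linarith)
  obtain ⟨_, ⟨l1, rfl⟩, h1⟩ := Metric.mem_closure_iff.1 hx1 (ε / 2) (by linarith)
  have hd : dist (torusMultiple α (2 * l1 + 1)) (torusMultiple α (2 * l0)) < ε := by
    have := dist_triangle_left (torusMultiple α (2 * l1 + 1)) (torusMultiple α (2 * l0)) x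
    linarith
  refine ⟨l1 - l0, fun i => ⟨round ((2 * ((l1 - l0 : ℤ) : ℝ) + 1) * α i), ?_⟩⟩
  have hi := (dist_le_pi_dist _ _ i).trans_lt hd
  rw [dist_eq_norm, torusMultiple, torusMultiple, ← AddCircle.coe_sub, UnitAddCircle.norm_eq] at hi
  have he : ((2 * l1 + 1 : ℤ) : ℝ) * α i - ((2 * l0 : ℤ) : ℝ) * α i
      = (2 * ((l1 - l0 : ℤ) : ℝ) + 1) * α i := by
    push_cast
    ring
  rwa [he] at hi

/-! ### Rational combinations of square roots -/

theorem normalizedTrace_eq_zero_of_sq {K : Type*} [Field K] [Algebra ℚ K] [Algebra.IsIntegral ℚ K]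
    (s : K) (D : ℕ) (hs : s ^ 2 = D) (hD : D = 0 ∨ ¬ IsSquare D) :
    Algebra.normalizedTrace ℚ K s = 0 := by
  rcases hD with rfl | hD
  · have : s = 0 := by simpa using hs
    rw [this, map_zero]
  · have hirr : Irreducible (Polynomial.X ^ 2 - Polynomial.C (D : ℚ)) := by
      refine (X_pow_sub_C_irreducible_iff_of_prime Nat.prime_two).2 fun b hb => hD ?_
      rw [← Rat.isSquare_natCast_iff]
      exact ⟨b, by rw [← hb, sq]⟩
    have hmin := minpoly.eq_of_irreducible_of_monic (x := s) hirr (by simp [hs])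
      (Polynomial.monic_X_pow_sub_C _ two_ne_zero)
    rw [Algebra.normalizedTrace_minpoly, ← hmin]
    have : (Polynomial.X ^ 2 - Polynomial.C (D : ℚ)).nextCoeff = 0 := by
      rw [Polynomial.nextCoeff_of_natDegree_pos
        (by rw [Polynomial.natDegree_X_pow_sub_C]; norm_num), Polynomial.natDegree_X_pow_sub_C,
        Polynomial.coeff_sub, Polynomial.coeff_X_pow, Polynomial.coeff_C]
      norm_num
    rw [this, neg_zero, smul_zero]

/-- An integer combination of square roots of nonsquare integers is zero if it is rational, since
each of these square roots has trace zero over `ℚ`. Vanishing radicands are allowed. -/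
theorem sum_sqrt_eq_zero_of_rational {ι : Type*} [Fintype ι] (D : ι → ℕ)
    (hD : ∀ i, D i = 0 ∨ ¬ IsSquare (D i)) (c : ι → ℤ) (q : ℚ)
    (h : ∑ i, c i * Real.sqrt (D i) = q) : q = 0 := by
  have hmem (i : ι) : Real.sqrt (D i) ∈ algebraicClosure ℚ ℝ := by
    rw [mem_algebraicClosure_iff]
    refine ⟨Polynomial.X ^ 2 - Polynomial.C (D i : ℚ),
      Polynomial.X_pow_sub_C_ne_zero two_pos _, ?_⟩
    simp
  let s (i : ι) : algebraicClosure ℚ ℝ := ⟨Real.sqrt (D i), hmem i⟩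
  have hs (i : ι) : s i ^ 2 = D i := by
    apply Subtype.ext
    simp [s]
  have h' : ∑ i, c i • s i = algebraMap ℚ (algebraicClosure ℚ ℝ) q := by
    apply Subtype.ext
    simp only [zsmul_eq_mul]
    push_cast
    simpa [s] using h
  have : Algebra.IsAlgebraic ℚ (algebraicClosure ℚ ℝ) := by
    convert algebraicClosure.isAlgebraic ℚ ℝ
    · rfl
    · exact Subsingleton.elim _ _
  have : Algebra.IsIntegral ℚ (algebraicClosure ℚ ℝ) := Algebra.IsAlgebraic.isIntegral
  have := congrArg (Algebra.normalizedTrace ℚ (algebraicClosure ℚ ℝ)) h'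
  rw [map_sum, Algebra.normalizedTrace_algebraMap_apply, Algebra.normalizedTrace_self_apply] at this
  rw [← this]
  refine Finset.sum_eq_zero fun i _ => ?_
  rw [map_zsmul, normalizedTrace_eq_zero_of_sq _ _ (hs i) (hD i), smul_zero]

/-- A square larger than `D ^ 2` and of the same parity is at least `(D + 2) ^ 2`. -/
theorem not_isSquare_sq_add_four_mul (D k : ℕ) (hk : 1 ≤ k) (h : k ≤ D) :
    ¬ IsSquare (D ^ 2 + 4 * k) := by
  rintro ⟨s, hs⟩
  have h1 : D < s := by nlinarith
  have h2 : s < D + 2 := by nlinarith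
  obtain rfl : s = D + 1 := by omega
  have : D ^ 2 + 4 * k = D ^ 2 + 2 * D + 1 := by rw [hs]; ring
  omega

/-! ### Transition matrices and eigenvectors -/

open Matrix in
/-- An eigenvector of a matrix is an eigenvector of its exponential. -/
theorem exp_mulVec_of_mulVec_eq_smul {n : Type*} [Fintype n] [DecidableEq n] {M : Matrix n n ℂ}
    {z : n → ℂ} {c : ℂ} (h : M *ᵥ z = c • z) : NormedSpace.exp M *ᵥ z = Complex.exp c • z := by
  let : NormedRing (Matrix n n ℂ) := Matrix.linftyOpNormedRing
  let : NormedAlgebra ℂ (Matrix n n ℂ) := Matrix.linftyOpNormedAlgebra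
  have hpow (k : ℕ) : (M ^ k) *ᵥ z = c ^ k • z := by
    induction k with
    | zero => simp
    | succ k ih => rw [pow_succ, ← mulVec_mulVec, h, mulVec_smul, ih, smul_smul, pow_succ, mul_comm]
  have h1 := (NormedSpace.exp_series_hasSum_exp' (𝕂 := ℂ) M).map
    (⟨⟨fun A => A *ᵥ z, zero_mulVec z⟩, fun A B => add_mulVec A B z⟩ : Matrix n n ℂ →+ (n → ℂ))
    (by
      change Continuous fun A : Matrix n n ℂ => A *ᵥ z
      fun_prop)
  have h2 := (NormedSpace.exp_series_hasSum_exp' (𝕂 := ℂ) c).smul_const z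
  rw [← Complex.exp_eq_exp_ℂ] at h2
  refine h1.unique (h2.congr_fun fun k => ?_)
  change ((k.factorial : ℂ)⁻¹ • M ^ k) *ᵥ z = _
  rw [smul_mulVec, hpow, smul_smul, smul_eq_mul]

open Classical in
theorem lapMatrix_mulVec_eq_sum {V : Type*} [Fintype V] (G : SimpleGraph V) {R : Type*} [Ring R]
    (z : V → R) (x : V) :
    (G.lapMatrix R).mulVec z x = ∑ y, if G.Adj x y then z x - z y else 0 := by
  rw [SimpleGraph.lapMatrix_mulVec_apply, SimpleGraph.degree_eq_sum_if_adj, Finset.sum_mul,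
    SimpleGraph.neighborFinset_eq_filter, Finset.sum_filter, ← Finset.sum_sub_distrib]
  refine Finset.sum_congr rfl fun y _ => ?_
  split_ifs <;> simp

open Classical in
theorem lapTransition_sum_of_eigenvector {V : Type*} [Fintype V] (G : SimpleGraph V) (t : ℝ)
    {z : V → ℂ} {c : ℂ} (h : ∀ x, (∑ y, if G.Adj x y then z x - z y else 0) = c * z x) (x : V) :
    ∑ y, lapTransition G t x y * z y = Complex.exp (-(Complex.I * t * c)) * z x := by
  have h1 : (G.lapMatrix ℂ).mulVec z = c • z := by
    funext x
    rw [lapMatrix_mulVec_eq_sum, h x, Pi.smul_apply, smul_eq_mul]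
  have h2 : ((-(Complex.I * (t : ℂ))) • G.lapMatrix ℂ).mulVec z = (-(Complex.I * t * c)) • z := by
    rw [Matrix.smul_mulVec, h1, smul_smul, neg_mul]
  exact congrFun (exp_mulVec_of_mulVec_eq_smul h2) x

/-! ### Eigenbases of the Laplacian and the eigenvalue support -/

open Classical in
/-- An orthonormal basis `vec i` of `ℝ^V` made of eigenvectors of the Laplacian of `G`, with
eigenvalues `val i`. It is indexed by `V` itself; both the orthogonality of the rows and that of
the columns of the change of basis matrix are recorded. -/
structure LapEigenbasis {V : Type*} [Fintype V] (G : SimpleGraph V) where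
  vec : V → V → ℝ
  val : V → ℝ
  mulVec_vec : ∀ i, (G.lapMatrix ℝ).mulVec (vec i) = val i • vec i
  sum_vec_mul_vec : ∀ i j, ∑ x, vec i x * vec j x = if i = j then 1 else 0
  sum_vec_apply : ∀ x y, ∑ i, vec i x * vec i y = if x = y then 1 else 0

namespace LapEigenbasis

variable {V : Type*} [Fintype V] {G : SimpleGraph V}

theorem nonempty (G : SimpleGraph V) : Nonempty (LapEigenbasis G) := by
  classical
  have hA := G.isHermitian_lapMatrix ℝ
  let b := hA.eigenvectorBasis
  have hin (x y : EuclideanSpace ℝ V) : inner ℝ x y = ∑ a, x a * y a := by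
    simp [PiLp.inner_apply, mul_comm]
  refine ⟨⟨fun i => b i, hA.eigenvalues, fun i => ?_, fun i j => ?_, fun x y => ?_⟩⟩
  · convert hA.mulVec_eigenvectorBasis i
  · rw [← hin, orthonormal_iff_ite.1 b.orthonormal]
  · have h := b.sum_inner_mul_inner (EuclideanSpace.single x (1 : ℝ)) (EuclideanSpace.single y 1)
    simp only [EuclideanSpace.inner_single_left, EuclideanSpace.inner_single_right, map_one,
      one_mul, conj_trivial] at h
    rw [h, PiLp.single_apply]
    simp only [eq_comm]

variable (B : LapEigenbasis G)

theorem sum_vec_mul_sum (f : V → ℝ) (y : V) :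
    ∑ i, B.vec i y * ∑ x, B.vec i x * f x = f y := by
  classical
  simp_rw [Finset.mul_sum, ← mul_assoc]
  rw [Finset.sum_comm]
  simp_rw [← Finset.sum_mul, B.sum_vec_apply]
  simp only [ite_mul, one_mul, zero_mul, Finset.sum_ite_eq, Finset.mem_univ, if_true]

theorem eq_of_vec_eq {u v : V} (h : ∀ i, B.vec i u = B.vec i v) : u = v := by
  by_contra huv
  have h1 := B.sum_vec_apply u v
  have h2 := B.sum_vec_apply v v
  rw [if_neg huv] at h1
  rw [if_pos rfl] at h2
  simp_rw [h] at h1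
  linarith

theorem sum_mul_eq_zero_of_eigenvalue_ne {z : V → ℝ} {μ : ℝ} {i : V}
    (hz : open Classical in (G.lapMatrix ℝ).mulVec z = μ • z) (hi : B.val i ≠ μ) :
    ∑ x, B.vec i x * z x = 0 := by
  classical
  have h1 : (G.lapMatrix ℝ).mulVec (B.vec i) ⬝ᵥ z = B.vec i ⬝ᵥ (G.lapMatrix ℝ).mulVec z := by
    rw [Matrix.dotProduct_mulVec, ← Matrix.mulVec_transpose, (G.isSymm_lapMatrix (R := ℝ)).eq]
  have h2 : B.val i * (B.vec i ⬝ᵥ z) = μ * (B.vec i ⬝ᵥ z) := by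
    have e1 : (G.lapMatrix ℝ).mulVec (B.vec i) = B.val i • B.vec i := by
      convert B.mulVec_vec i
    have e2 : (G.lapMatrix ℝ).mulVec z = μ • z := by convert hz
    rw [e1, e2] at h1
    simpa [smul_dotProduct, dotProduct_smul] using h1
  have h3 : (B.val i - μ) * (B.vec i ⬝ᵥ z) = 0 := by linear_combination h2
  exact (mul_eq_zero.1 h3).resolve_left (sub_ne_zero.2 hi)

theorem mem_lapSupport_iff {u : V} {μ : ℝ} :
    μ ∈ lapSupport G u ↔ ∃ i, B.val i = μ ∧ B.vec i u ≠ 0 := by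
  classical
  have hin (z : EuclideanSpace ℝ V) : inner ℝ z (EuclideanSpace.single u (1 : ℝ)) = z u := by
    simp [EuclideanSpace.inner_single_right]
  have hsp : lapEigenprojector G μ (EuclideanSpace.single u (1 : ℝ)) = 0 ↔
      ∀ z ∈ Module.End.eigenspace (lapOperator G) μ, z u = 0 := by
    rw [lapEigenprojector, Submodule.starProjection_apply_eq_zero_iff, Submodule.mem_orthogonal]
    simp only [hin]
  have hmem (z : EuclideanSpace ℝ V) : z ∈ Module.End.eigenspace (lapOperator G) μ ↔
      (open Classical in (G.lapMatrix ℝ).mulVec z = μ • (z : V → ℝ)) := by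
    rw [Module.End.mem_eigenspace_iff, lapOperator]
    exact ⟨fun h => congrArg WithLp.ofLp h, fun h => WithLp.ofLp_injective _ h⟩
  constructor
  · rintro ⟨-, h⟩
    by_contra! hno
    refine h (hsp.2 fun z hz => ?_)
    have h1 : ∀ i, B.vec i u * ∑ x, B.vec i x * z x = 0 := fun i => by
      by_cases hi : B.val i = μ
      · rw [hno i hi, zero_mul]
      · rw [B.sum_mul_eq_zero_of_eigenvalue_ne ((hmem z).1 hz) hi, mul_zero]
    rw [← B.sum_vec_mul_sum z u]
    exact Finset.sum_eq_zero fun i _ => h1 i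
  · rintro ⟨i, rfl, hi⟩
    have hz : (WithLp.toLp 2 (B.vec i) : EuclideanSpace ℝ V) ∈
        Module.End.eigenspace (lapOperator G) (B.val i) := (hmem _).2 (B.mulVec_vec i)
    refine ⟨Module.End.hasEigenvalue_of_hasEigenvector ⟨hz, fun h0 => hi ?_⟩,
      fun h => hi (hsp.1 h _ hz)⟩
    exact congrArg (fun z : EuclideanSpace ℝ V => z u) h0

theorem val_nonneg (i : V) : 0 ≤ B.val i := by
  classical
  have h := (G.posSemidef_lapMatrix ℝ).dotProduct_mulVec_nonneg (B.vec i)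
  have e1 : (G.lapMatrix ℝ).mulVec (B.vec i) = B.val i • B.vec i := by convert B.mulVec_vec i
  rw [e1, dotProduct_smul, star_trivial, smul_eq_mul] at h
  have h2 : B.vec i ⬝ᵥ B.vec i = 1 := (B.sum_vec_mul_vec i i).trans (if_pos rfl)
  rwa [h2, mul_one] at h

theorem sum_vec_eq_zero {i : V} (hi : B.val i ≠ 0) : ∑ x, B.vec i x = 0 := by
  classical
  have h := B.sum_mul_eq_zero_of_eigenvalue_ne (z := fun _ => 1) (μ := 0) (i := i)
    (by rw [zero_smul]; convert G.lapMatrix_mulVec_const_eq_zero (R := ℝ)) hi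
  simpa using h

theorem vec_eq_of_val_eq_zero (hG : G.Connected) {i : V} (hi : B.val i = 0) (x y : V) :
    B.vec i x = B.vec i y := by
  classical
  have h := B.mulVec_vec i
  rw [hi, zero_smul] at h
  exact G.lapMatrix_mulVec_eq_zero_iff_forall_reachable.1 h x y (hG.preconnected x y)

theorem eq_sum_mul_vec (r : V → ℂ) (v : V) :
    r v = ∑ i, (∑ a, r a * B.vec i a) * B.vec i v := by
  classical
  have h2 (y : V) : ∑ i, (B.vec i y : ℂ) * B.vec i v = if y = v then 1 else 0 := by
    simp_rw [← Complex.ofReal_mul]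
    rw [← Complex.ofReal_sum, B.sum_vec_apply]
    split_ifs <;> simp
  simp_rw [Finset.sum_mul, mul_assoc]
  rw [Finset.sum_comm]
  simp_rw [← Finset.mul_sum, h2]
  simp only [mul_ite, mul_one, mul_zero, Finset.sum_ite_eq', Finset.mem_univ, if_true]

theorem lapTransition_apply (t : ℝ) (u v : V) : lapTransition G t u v =
    ∑ i, Complex.exp (-(Complex.I * t * B.val i)) * (B.vec i u * B.vec i v : ℝ) := by
  classical
  have h1 (i : V) : ∑ y, lapTransition G t u y * (B.vec i y : ℂ) =
      Complex.exp (-(Complex.I * t * B.val i)) * B.vec i u := by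
    refine lapTransition_sum_of_eigenvector G t (z := fun y => (B.vec i y : ℂ)) (fun x => ?_) u
    have := congrFun (B.mulVec_vec i) x
    rw [lapMatrix_mulVec_eq_sum] at this
    have h2 := congrArg (fun r : ℝ => (r : ℂ)) this
    simp only [Complex.ofReal_sum, Pi.smul_apply, smul_eq_mul, Complex.ofReal_mul] at h2
    rw [← h2]
    refine Finset.sum_congr rfl fun y _ => ?_
    split_ifs <;> simp
  rw [B.eq_sum_mul_vec (lapTransition G t u) v]
  refine Finset.sum_congr rfl fun i _ => ?_
  rw [h1 i, Complex.ofReal_mul, mul_assoc]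

/-- The equality case of the Cauchy-Schwarz inequality for the expansion of the transition
amplitude in the eigenbasis. The common phase is `1` because the transition matrix fixes the
all-ones vector. -/
theorem exp_mul_vec_eq_of_norm_eq_one {u v : V} {τ : ℝ} (h : ‖lapTransition G τ u v‖ = 1) (i : V) :
    Complex.exp (-(Complex.I * τ * B.val i)) * B.vec i u = B.vec i v := by
  classical
  set γ := lapTransition G τ u v with hγ
  set E : V → ℂ := fun i => Complex.exp (-(Complex.I * τ * B.val i)) with hE
  have hEn (i) : Complex.normSq (E i) = 1 := by
    rw [Complex.normSq_eq_norm_sq, hE]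
    simp [Complex.norm_exp]
  have hγn : Complex.normSq γ = 1 := by rw [Complex.normSq_eq_norm_sq, h, one_pow]
  have hsum : ∑ i, Complex.normSq (E i * B.vec i u - γ * B.vec i v) = 0 := by
    have h1 (i) : Complex.normSq (E i * B.vec i u - γ * B.vec i v) =
        B.vec i u * B.vec i u + B.vec i v * B.vec i v
          - 2 * ((starRingEnd ℂ) γ * (E i * (B.vec i u * B.vec i v : ℝ))).re := by
      rw [Complex.normSq_sub, Complex.normSq_mul, Complex.normSq_mul, hEn, hγn,
        Complex.normSq_ofReal, Complex.normSq_ofReal]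
      simp
      ring
    simp_rw [h1]
    rw [Finset.sum_sub_distrib, Finset.sum_add_distrib, B.sum_vec_apply, B.sum_vec_apply,
      ← Finset.mul_sum, ← Complex.re_sum, ← Finset.mul_sum, ← B.lapTransition_apply, ← hγ,
      mul_comm ((starRingEnd ℂ) γ), Complex.mul_conj, hγn]
    norm_num
  have hEγ (i) : E i * B.vec i u = γ * B.vec i v := by
    have := (Finset.sum_eq_zero_iff_of_nonneg fun i _ => Complex.normSq_nonneg _).1 hsum i
      (Finset.mem_univ i)
    exact sub_eq_zero.1 (Complex.normSq_eq_zero.1 this)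
  have hones (x : V) : ∑ i, (B.vec i x : ℂ) * ((∑ y, B.vec i y : ℝ) : ℂ) = 1 := by
    have := B.sum_vec_mul_sum (fun _ => 1) x
    simp only [mul_one] at this
    exact_mod_cast this
  have hγ1 : γ = 1 := by
    rw [← mul_one γ, ← hones v, Finset.mul_sum, hones v]
    refine Eq.trans ?_ (hones u)
    refine Finset.sum_congr rfl fun i _ => ?_
    rw [← mul_assoc, ← hEγ]
    by_cases hi : B.val i = 0
    · simp [hE, hi]
    · simp [B.sum_vec_eq_zero hi]
  have := hEγ i
  rwa [hγ1, one_mul] at this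

/-! ### Rationality and integrality of the support -/

theorem isIntegral_val (i : V) : IsIntegral ℤ (B.val i) := by
  classical
  refine ⟨(G.lapMatrix ℤ).charpoly, Matrix.charpoly_monic _, ?_⟩
  have hmap : (G.lapMatrix ℤ).map (algebraMap ℤ ℝ) = G.lapMatrix ℝ := by
    ext x y
    simp [SimpleGraph.lapMatrix, SimpleGraph.degMatrix, Matrix.diagonal_apply,
      SimpleGraph.adjMatrix_apply, apply_ite (Int.cast : ℤ → ℝ)]
  rw [← Polynomial.eval_map, ← Matrix.charpoly_map, hmap, Matrix.eval_charpoly,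
    ← Matrix.exists_mulVec_eq_zero_iff]
  refine ⟨B.vec i, fun h => ?_, ?_⟩
  · have := B.sum_vec_mul_vec i i
    simp [h] at this
  · have e1 : (G.lapMatrix ℝ).mulVec (B.vec i) = B.val i • B.vec i := by convert B.mulVec_vec i
    rw [Matrix.sub_mulVec, e1, Matrix.scalar_apply]
    ext x
    simp

/-- The entries of the powers of the Laplacian, written in the eigenbasis, are rational. -/
theorem exists_rat_moment (u : V) (j : ℕ) (x : V) :
    ∃ r : ℚ, ∑ i, B.vec i x * B.vec i u * B.val i ^ j = r := by
  classical
  induction j generalizing x with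
  | zero =>
    refine ⟨if x = u then 1 else 0, ?_⟩
    simp only [pow_zero, mul_one, B.sum_vec_apply]
    split_ifs <;> simp
  | succ j ih =>
    choose r hr using ih
    refine ⟨∑ y, if G.Adj x y then r x - r y else 0, ?_⟩
    have h1 (i : V) : B.vec i x * B.vec i u * B.val i ^ (j + 1) =
        ∑ y, if G.Adj x y then B.vec i x * B.vec i u * B.val i ^ j
          - B.vec i y * B.vec i u * B.val i ^ j else 0 := by
      have h := congrFun (B.mulVec_vec i) x
      rw [lapMatrix_mulVec_eq_sum, Pi.smul_apply, smul_eq_mul] at h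
      calc _ = (B.val i * B.vec i x) * (B.vec i u * B.val i ^ j) := by ring
        _ = _ := by
          rw [← h, Finset.sum_mul]
          refine Finset.sum_congr rfl fun y _ => ?_
          split_ifs <;> ring
    simp_rw [h1]
    rw [Finset.sum_comm]
    push_cast
    refine Finset.sum_congr rfl fun y _ => ?_
    split_ifs
    · rw [Finset.sum_sub_distrib, hr, hr, Rat.cast_sub]
    · simp

open Classical in
/-- The eigenvalue support of `u`, as the finite set of eigenvalues whose basis vectors do not
vanish at `u`. -/
noncomputable def support (u : V) : Finset ℝ :=
  (Finset.univ.filter fun i => B.vec i u ≠ 0).image B.val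

theorem mem_support {u : V} {μ : ℝ} : μ ∈ B.support u ↔ ∃ i, B.val i = μ ∧ B.vec i u ≠ 0 := by
  simp [support, and_comm]

/-- If `p = ∑ j < d, c j * X ^ j` satisfies `p(L) e_u = 0`, then `p` vanishes on the support of
`u`. -/
theorem sum_coeff_mul_pow_eq_zero {u : V} {d : ℕ} {c : ℕ → ℝ}
    (h : ∀ x, ∑ j ∈ Finset.range d, c j * ∑ i, B.vec i x * B.vec i u * B.val i ^ j = 0)
    {i : V} (hi : B.vec i u ≠ 0) : ∑ j ∈ Finset.range d, c j * B.val i ^ j = 0 := by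
  classical
  have h1 (x : V) : ∑ i, B.vec i x * (B.vec i u * ∑ j ∈ Finset.range d, c j * B.val i ^ j) = 0 := by
    rw [← h x]
    simp_rw [Finset.mul_sum]
    rw [Finset.sum_comm]
    refine Finset.sum_congr rfl fun j _ => Finset.sum_congr rfl fun i _ => ?_
    ring
  have h2 : ∑ x, B.vec i x *
      ∑ l, B.vec l x * (B.vec l u * ∑ j ∈ Finset.range d, c j * B.val l ^ j) = 0 :=
    Finset.sum_eq_zero fun x _ => by rw [h1, mul_zero]
  simp_rw [Finset.mul_sum (Finset.univ : Finset V), ← mul_assoc] at h2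
  rw [Finset.sum_comm] at h2
  simp_rw [← Finset.sum_mul, B.sum_vec_mul_vec] at h2
  simp only [ite_mul, one_mul, zero_mul, Finset.sum_ite_eq, Finset.mem_univ, if_true] at h2
  exact (mul_eq_zero.1 h2).resolve_left hi

/-- The sum of the eigenvalue support is rational. The monic polynomial `p` with simple roots at
the support is the unique monic polynomial of its degree with `p(L) e_u = 0`, and applying to its
coefficients a `ℚ`-linear retraction `ℝ → ℚ` gives another such polynomial. -/
theorem exists_rat_sum_support (u : V) : ∃ q : ℚ, ∑ μ ∈ B.support u, μ = q := by
  classical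
  rcases (B.support u).eq_empty_or_nonempty with he | hne
  · exact ⟨0, by simp [he]⟩
  obtain ⟨f, hf⟩ := (Algebra.linearMap ℚ ℝ).exists_leftInverse_of_injective
    (LinearMap.ker_eq_bot.2 (algebraMap ℚ ℝ).injective)
  have hfq (q : ℚ) : f q = q := LinearMap.congr_fun hf q
  have hfmul (a : ℝ) (q : ℚ) : f (a * q) = f a * q := by
    have : a * (q : ℝ) = q • a := by rw [Rat.smul_def, mul_comm]
    rw [this, map_smul, smul_eq_mul, mul_comm]
  set p : Polynomial ℝ := ∏ μ ∈ B.support u, (Polynomial.X - Polynomial.C μ) with hp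
  set d := (B.support u).card with hd
  have hdpos : 0 < d := Finset.card_pos.2 hne
  have hpm : p.Monic := Polynomial.monic_prod_of_monic _ _ fun μ _ => Polynomial.monic_X_sub_C μ
  have hpd : p.natDegree = d := by
    rw [hp, Polynomial.natDegree_prod_of_monic _ _ fun μ _ => Polynomial.monic_X_sub_C μ]
    simp [hd]
  have hpz {i : V} (hi : B.vec i u ≠ 0) :
      ∑ j ∈ Finset.range (d + 1), p.coeff j * B.val i ^ j = 0 := by
    rw [← hpd, ← Polynomial.eval_eq_sum_range, hp, Polynomial.eval_prod]
    exact Finset.prod_eq_zero (B.mem_support.2 ⟨i, rfl, hi⟩) (by simp)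
  have hfz {i : V} (hi : B.vec i u ≠ 0) :
      ∑ j ∈ Finset.range (d + 1), (f (p.coeff j) : ℝ) * B.val i ^ j = 0 := by
    refine B.sum_coeff_mul_pow_eq_zero (u := u) (c := fun j => (f (p.coeff j) : ℝ))
      (fun x => ?_) hi
    have h0 : ∑ j ∈ Finset.range (d + 1),
        p.coeff j * ∑ i, B.vec i x * B.vec i u * B.val i ^ j = 0 := by
      simp_rw [Finset.mul_sum]
      rw [Finset.sum_comm]
      refine Finset.sum_eq_zero fun i _ => ?_
      by_cases hi : B.vec i u = 0
      · simp [hi]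
      · calc _ = B.vec i x * B.vec i u * ∑ j ∈ Finset.range (d + 1), p.coeff j * B.val i ^ j := by
              rw [Finset.mul_sum]
              refine Finset.sum_congr rfl fun j _ => by ring
          _ = 0 := by rw [hpz hi, mul_zero]
    choose r hr using fun j => B.exists_rat_moment u j x
    simp_rw [hr] at h0 ⊢
    have h1 := congrArg f h0
    rw [map_sum, map_zero] at h1
    simp_rw [hfmul] at h1
    exact_mod_cast h1
  set r : Polynomial ℝ := ∑ j ∈ Finset.range d,
    Polynomial.C (p.coeff j - f (p.coeff j)) * Polynomial.X ^ j with hr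
  have hr0 : r = 0 := by
    refine Polynomial.eq_zero_of_degree_lt_of_eval_finset_eq_zero (B.support u) ?_ fun μ hμ => ?_
    · rw [hr]
      refine (Polynomial.degree_sum_le _ _).trans_lt ((Finset.sup_lt_iff ?_).2 fun j hj => ?_)
      · exact WithBot.bot_lt_coe _
      · refine (Polynomial.degree_C_mul_X_pow_le _ _).trans_lt ?_
        exact_mod_cast Finset.mem_range.1 hj
    · obtain ⟨i, rfl, hi⟩ := B.mem_support.1 hμ
      have h1 := hpz hi
      have h2 := hfz hi
      rw [Finset.sum_range_succ] at h1 h2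
      have hc : p.coeff d = 1 := by rw [← hpd]; exact hpm
      have hf1 : f 1 = 1 := by exact_mod_cast hfq 1
      rw [hc, hf1] at h2
      rw [hc] at h1
      rw [hr, Polynomial.eval_finsetSum]
      simp only [Polynomial.eval_mul, Polynomial.eval_C, Polynomial.eval_pow, Polynomial.eval_X,
        sub_mul, Finset.sum_sub_distrib]
      push_cast at h2
      linarith
  have hcoeff : p.coeff (d - 1) = f (p.coeff (d - 1)) := by
    have h1 : r.coeff (d - 1) = p.coeff (d - 1) - f (p.coeff (d - 1)) := by
      rw [hr, Polynomial.finsetSum_coeff]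
      simp only [Polynomial.coeff_C_mul_X_pow]
      rw [Finset.sum_ite_eq, if_pos (Finset.mem_range.2 (by omega))]
    rw [hr0, Polynomial.coeff_zero] at h1
    linarith
  rw [hp, hd, Polynomial.prod_X_sub_C_coeff_card_pred _ _ hdpos] at hcoeff
  refine ⟨-f (-∑ μ ∈ B.support u, μ), ?_⟩
  push_cast
  rw [← hcoeff, neg_neg]

/-- If all eigenvalues in the support of `u` are integer multiples of one real number, then they
are integers: their sum is rational and they are nonnegative, so their ratios being rational makes
each of them rational, and they are algebraic integers. -/
theorem exists_int_of_commensurable {u : V} {τ : ℝ}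
    (h : ∀ i, B.vec i u ≠ 0 → ∃ z : ℤ, τ * B.val i = Real.pi * z)
    (hne : ∃ i, B.vec i u ≠ 0 ∧ τ * B.val i ≠ 0) {i : V} (hi : B.vec i u ≠ 0) :
    ∃ m : ℤ, B.val i = m := by
  obtain ⟨q, hq⟩ := B.exists_rat_sum_support u
  obtain ⟨i₀, hi₀, hi₀'⟩ := hne
  have hτ : τ ≠ 0 := left_ne_zero_of_mul hi₀'
  have hnn : ∀ μ ∈ B.support u, 0 ≤ μ := fun μ hμ => by
    obtain ⟨i, rfl, -⟩ := B.mem_support.1 hμ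
    exact B.val_nonneg i
  have hqpos : 0 < (q : ℝ) := by
    rw [← hq]
    refine Finset.sum_pos' hnn ⟨B.val i₀, B.mem_support.2 ⟨i₀, rfl, hi₀⟩, ?_⟩
    exact lt_of_le_of_ne (B.val_nonneg i₀) (right_ne_zero_of_mul hi₀').symm
  have hZ : ∃ Z : ℤ, τ * q = Real.pi * Z := by
    have : ∀ μ ∈ B.support u, ∃ z : ℤ, τ * μ = Real.pi * z := fun μ hμ => by
      obtain ⟨i, rfl, hi⟩ := B.mem_support.1 hμ
      exact h i hi
    choose! z hz using this
    refine ⟨∑ μ ∈ B.support u, z μ, ?_⟩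
    rw [← hq, Finset.mul_sum, Finset.sum_congr rfl hz, ← Finset.mul_sum]
    push_cast
    rfl
  obtain ⟨Z, hZ⟩ := hZ
  obtain ⟨z, hz⟩ := h i hi
  have hZ0 : (Z : ℝ) ≠ 0 := by
    intro h0
    rw [h0, mul_zero] at hZ
    exact mul_ne_zero hτ hqpos.ne' hZ
  have hval : B.val i = ((q * z / Z : ℚ) : ℝ) := by
    push_cast
    rw [eq_div_iff hZ0]
    apply mul_left_cancel₀ (mul_ne_zero hτ Real.pi_ne_zero)
    linear_combination (Real.pi * Z) * hz - (Real.pi * z) * hZ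
  have hint : IsIntegral ℤ (q * z / Z : ℚ) := by
    rw [← isIntegral_algebraMap_iff (B := ℝ) (algebraMap ℚ ℝ).injective]
    have := B.isIntegral_val i
    rw [hval] at this
    exact this
  obtain ⟨m, hm⟩ := IsIntegrallyClosed.isIntegral_iff.1 hint
  refine ⟨m, ?_⟩
  rw [hval, ← hm]
  simp

/-! ### Phases of perfect state transfer -/

/-- Perfect state transfer in the eigenbasis: at the time `τ` every phase that matters is a sign,
and since `u ≠ v` the sign `-1` occurs. -/
theorem exists_int_phase {u v : V} (huv : u ≠ v) {τ : ℝ}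
    (h : ∀ i, Complex.exp (-(Complex.I * τ * B.val i)) * B.vec i u = B.vec i v) :
    (∀ i, B.vec i u ≠ 0 → ∃ z : ℤ, τ * B.val i = Real.pi * z) ∧
      ∃ i, B.vec i u ≠ 0 ∧ ∃ z : ℤ, Odd z ∧ τ * B.val i = Real.pi * z := by
  have hint : ∀ i, B.vec i u ≠ 0 → ∃ z : ℤ, τ * B.val i = Real.pi * z := fun i hi => by
    have him := congrArg Complex.im (h i)
    rw [Complex.im_mul_ofReal, Complex.ofReal_im] at him
    have h1 : -(Complex.I * τ * B.val i) = ((-(τ * B.val i) : ℝ) : ℂ) * Complex.I := by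
      push_cast
      ring
    rw [h1, Complex.exp_ofReal_mul_I_im, Real.sin_neg] at him
    obtain ⟨z, hz⟩ := Real.sin_eq_zero_iff.1
      (neg_eq_zero.1 ((mul_eq_zero.1 him).resolve_right hi))
    exact ⟨z, by rw [← hz, mul_comm]⟩
  refine ⟨hint, ?_⟩
  by_contra! hno
  refine huv (B.eq_of_vec_eq fun i => ?_)
  have hi' := h i
  by_cases hi : B.vec i u = 0
  · rw [hi, Complex.ofReal_zero, mul_zero] at hi'
    rw [hi]
    exact_mod_cast hi'
  · obtain ⟨z, hz⟩ := hint i hi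
    have hev : Even z := Int.not_odd_iff_even.1 fun ho => hno i hi z ho hz
    obtain ⟨r, rfl⟩ := hev
    have h1 : Complex.exp (-(Complex.I * τ * B.val i)) = 1 := by
      rw [Complex.exp_eq_one_iff]
      refine ⟨-r, ?_⟩
      have hz' : (τ : ℂ) * B.val i = Real.pi * ((r + r : ℤ) : ℂ) := by exact_mod_cast hz
      rw [mul_assoc, hz']
      push_cast
      ring
    rw [h1, one_mul] at hi'
    exact_mod_cast hi'

/-- The powers of `2` dividing a set of eigenvalues that are integers, not all zero, have a
greatest member. -/
theorem exists_isGreatest_twoPow {u : V} (hint : ∀ i, B.vec i u ≠ 0 → ∃ m : ℤ, B.val i = m)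
    (hne : ∃ i, B.vec i u ≠ 0 ∧ B.val i ≠ 0) :
    ∃ e : ℕ, IsGreatest {m : ℕ | TwoPowDividesAll (lapSupport G u) m} e := by
  obtain ⟨i, hi, hi0⟩ := hne
  have hbdd : BddAbove {m : ℕ | TwoPowDividesAll (lapSupport G u) m} := by
    obtain ⟨m, hm⟩ := hint i hi
    refine ⟨m.natAbs, fun l hl => ?_⟩
    obtain ⟨z, hz⟩ := hl _ (B.mem_lapSupport_iff.2 ⟨i, rfl, hi⟩)
    have hmz : m = 2 ^ l * z := by
      rw [hm] at hz
      exact_mod_cast hz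
    have hm0 : m ≠ 0 := by
      rintro rfl
      exact hi0 (by simpa using hm)
    have h1 : (2 ^ l : ℤ).natAbs ∣ m.natAbs := Int.natAbs_dvd_natAbs.2 ⟨z, hmz⟩
    have h2 : 2 ^ l ≤ m.natAbs := by
      simpa [Int.natAbs_pow] using Nat.le_of_dvd (Int.natAbs_pos.2 hm0) h1
    exact Nat.lt_two_pow_self.le.trans h2
  refine ⟨_, Nat.sSup_mem ⟨0, fun μ hμ => ?_⟩ hbdd, fun m hm => le_csSup hbdd hm⟩
  obtain ⟨l, rfl, hl⟩ := B.mem_lapSupport_iff.1 hμ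
  obtain ⟨m, hm⟩ := hint l hl
  exact ⟨m, by rw [hm, pow_zero, one_mul]⟩

/-- If `2 ^ e` is the greatest power of `2` dividing the support, then the phase `z` of perfect
state transfer has the parity of the eigenvalue divided by `2 ^ e`: the ratios of the phases and of
the eigenvalues agree, and in both families some member is odd. -/
theorem even_sub_of_isGreatest {u : V} {τ : ℝ} {e : ℕ}
    (he : IsGreatest {m : ℕ | TwoPowDividesAll (lapSupport G u) m} e)
    (hodd : ∃ i, B.vec i u ≠ 0 ∧ ∃ z : ℤ, Odd z ∧ τ * B.val i = Real.pi * z)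
    (hint : ∀ i, B.vec i u ≠ 0 → ∃ z : ℤ, τ * B.val i = Real.pi * z)
    {i : V} (hi : B.vec i u ≠ 0) :
    ∃ m z : ℤ, B.val i = 2 ^ e * m ∧ τ * B.val i = Real.pi * z ∧ Even (m - z) := by
  have hdiv : ∀ i, B.vec i u ≠ 0 → ∃ m : ℤ, B.val i = 2 ^ e * m := fun i hi =>
    he.1 _ (B.mem_lapSupport_iff.2 ⟨i, rfl, hi⟩)
  have hoddm : ∃ i, B.vec i u ≠ 0 ∧ ∃ m : ℤ, Odd m ∧ B.val i = 2 ^ e * m := by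
    by_contra! hno
    have : TwoPowDividesAll (lapSupport G u) (e + 1) := fun μ hμ => by
      obtain ⟨l, rfl, hl⟩ := B.mem_lapSupport_iff.1 hμ
      obtain ⟨m, hm⟩ := hdiv l hl
      obtain ⟨r, rfl⟩ := Int.not_odd_iff_even.1 fun ho => hno l hl m ho hm
      refine ⟨r, ?_⟩
      rw [hm]
      push_cast
      ring
    have := he.2 this
    omega
  obtain ⟨i₀, hi₀, m₀, hm₀odd, hm₀⟩ := hoddm
  obtain ⟨i₁, hi₁, z₁, hz₁odd, hz₁⟩ := hodd
  obtain ⟨z₀, hz₀⟩ := hint i₀ hi₀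
  have cross {l : V} {m z : ℤ} (hm : B.val l = 2 ^ e * m) (hz : τ * B.val l = Real.pi * z) :
      z * m₀ = m * z₀ := by
    have : (z : ℝ) * m₀ = m * z₀ := by
      apply mul_left_cancel₀ Real.pi_ne_zero
      rw [hm] at hz
      rw [hm₀] at hz₀
      linear_combination (-(m₀ : ℝ)) * hz + m * hz₀
    exact_mod_cast this
  have hz₀odd : Odd z₀ := by
    obtain ⟨m₁, hm₁⟩ := hdiv i₁ hi₁
    have h1 : Odd (m₁ * z₀) := cross hm₁ hz₁ ▸ hz₁odd.mul hm₀odd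
    exact (Int.odd_mul.1 h1).2
  obtain ⟨m, hm⟩ := hdiv i hi
  obtain ⟨z, hz⟩ := hint i hi
  refine ⟨m, z, hm, hz, ?_⟩
  have h1 := congrArg Even (cross hm hz)
  rw [Int.even_mul, Int.even_mul] at h1
  have h2 := Int.not_even_iff_odd.2 hm₀odd
  have h3 := Int.not_even_iff_odd.2 hz₀odd
  rw [Int.even_sub]
  simp only [h2, h3, or_false] at h1
  rw [h1]

end LapEigenbasis

/-! ### The Laplacian of the vertex complemented corona -/

section Corona

variable {V : Type*} {W : V → Type*} (G : SimpleGraph V) (H : ∀ v, SimpleGraph (W v))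

theorem vertexComplementedCorona_adj_inl_inl (a b : V) :
    (vertexComplementedCorona G H).Adj (Sum.inl a) (Sum.inl b) ↔ G.Adj a b :=
  ⟨fun h => by cases h with | base _ _ h => exact h, fun h => VCCAdj.base a b h⟩

theorem vertexComplementedCorona_adj_inl_inr (a b : V) (w : W b) :
    (vertexComplementedCorona G H).Adj (Sum.inl a) (Sum.inr ⟨b, w⟩) ↔ a ≠ b :=
  ⟨fun h => by cases h with | joinLeft _ _ _ h => exact h, fun h => VCCAdj.joinLeft a b w h⟩

theorem vertexComplementedCorona_adj_inr_inl (a b : V) (w : W b) :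
    (vertexComplementedCorona G H).Adj (Sum.inr ⟨b, w⟩) (Sum.inl a) ↔ a ≠ b :=
  ⟨fun h => by cases h with | joinRight _ _ _ h => exact h, fun h => VCCAdj.joinRight a b w h⟩

theorem fst_eq_of_vertexComplementedCorona_adj_inr_inr (s s' : Σ v, W v)
    (h : (vertexComplementedCorona G H).Adj (Sum.inr s) (Sum.inr s')) : s.1 = s'.1 := by
  cases h with
  | copy _ _ _ _ => rfl

variable [Fintype V] [∀ v, Fintype (W v)]

open Classical in
/-- The vector `(p f, q f ⊗ 1)` is an eigenvector of the Laplacian of the corona as soon as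
`(p, q)` is an eigenvector of the two by two quotient matrix. Here `f` is an eigenvector of the Laplacian of
`G` which is also an eigenvector, of eigenvalue `-β`, of `J - I`, where `J` is the all-ones
matrix. -/
theorem corona_eigenvector {k : ℕ} (hW : ∀ v, Fintype.card (W v) = k) {f : V → ℂ} {s β p q c : ℂ}
    (hf : ∀ x, (∑ y, if G.Adj x y then f x - f y else 0) = s * f x)
    (hβ : ∀ a, ∑ b, f b - f a = -β * f a)
    (h1 : (s + (Fintype.card V - 1) * k) * p + k * β * q = c * p)
    (h2 : (Fintype.card V - 1) * q + β * p = c * q) (x : V ⊕ (Σ v, W v)) :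
    (∑ y, if (vertexComplementedCorona G H).Adj x y then
      Sum.elim (fun a => p * f a) (fun s => q * f s.1) x -
        Sum.elim (fun a => p * f a) (fun s => q * f s.1) y else 0) =
      c * Sum.elim (fun a => p * f a) (fun s => q * f s.1) x := by
  have hoff (a : V) (F : V → ℂ) : (∑ b, if b ≠ a then F b else 0) = ∑ b, F b - F a := by
    rw [← Finset.sum_filter, Finset.filter_ne', eq_sub_iff_add_eq, add_comm,
      Finset.add_sum_erase _ _ (Finset.mem_univ a)]
  rw [Fintype.sum_sum_type]
  rcases x with a | ⟨a, w⟩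
  · simp only [Sum.elim_inl, Sum.elim_inr, Fintype.sum_sigma,
      vertexComplementedCorona_adj_inl_inl, vertexComplementedCorona_adj_inl_inr,
      Finset.sum_const, Finset.card_univ, hW, nsmul_eq_mul]
    have e1 : (∑ b, if G.Adj a b then p * f a - p * f b else 0) = p * (s * f a) := by
      rw [← hf a, Finset.mul_sum]
      refine Finset.sum_congr rfl fun b _ => ?_
      split_ifs <;> ring
    have e2 : (∑ b, (k : ℂ) * if a ≠ b then p * f a - q * f b else 0) =
        k * ((Fintype.card V - 1) * (p * f a) + q * (β * f a)) := by
      rw [← Finset.mul_sum]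
      simp only [ne_comm (a := a)]
      rw [hoff a, Finset.sum_sub_distrib, ← Finset.mul_sum (f := f), Finset.sum_const,
        Finset.card_univ, nsmul_eq_mul]
      linear_combination (-k * q) * hβ a
    rw [e1, e2]
    linear_combination (f a) * h1
  · simp only [Sum.elim_inl, Sum.elim_inr, vertexComplementedCorona_adj_inr_inl]
    have e1 : (∑ b, if b ≠ a then q * f a - p * f b else 0) =
        (Fintype.card V - 1) * (q * f a) + p * (β * f a) := by
      rw [hoff a, Finset.sum_sub_distrib, ← Finset.mul_sum (f := f), Finset.sum_const,
        Finset.card_univ, nsmul_eq_mul]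
      linear_combination (-p) * hβ a
    have e2 : (∑ y : Σ v, W v,
        if (vertexComplementedCorona G H).Adj (Sum.inr ⟨a, w⟩) (Sum.inr y) then
          q * f a - q * f y.1 else 0) = 0 := by
      refine Finset.sum_eq_zero fun y _ => ?_
      split_ifs with h
      · rw [← fst_eq_of_vertexComplementedCorona_adj_inr_inr G H _ _ h, sub_self]
      · rfl
    rw [e1, e2]
    linear_combination (f a) * h2

/-- The transition matrix of the corona, compressed to the vertices of `G`, acts as a scalar on
an eigenvector `f` of the Laplacian of `G` for the eigenvalue `s`. With `n = |V|`, the two by two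
quotient matrix has trace `s + (n - 1) (1 + k)` and diagonal difference `D = s + (n - 1) (k - 1)`;
its eigenvalues differ by `δ`, and `(1, 0)` is a multiple of the difference of its
eigenvectors. -/
theorem lapTransition_corona_sum {k : ℕ} (hW : ∀ v, Fintype.card (W v) = k) {f : V → ℂ}
    {s β D δ : ℝ}
    (hf : open Classical in ∀ x, (∑ y, if G.Adj x y then f x - f y else 0) = s * f x)
    (hβ : ∀ a, ∑ b, f b - f a = -β * f a)
    (hD : D = s + (Fintype.card V - 1) * (k - 1)) (hδ : δ ≠ 0)
    (hδ2 : δ ^ 2 = D ^ 2 + 4 * k * β ^ 2) (t : ℝ) (u : V) :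
    ∑ a, lapTransition (vertexComplementedCorona G H) t (Sum.inl u) (Sum.inl a) * f a =
      Complex.exp (-(Complex.I * t * ((s + (Fintype.card V - 1) * (1 + k) : ℝ) / 2))) *
        (((D + δ) / (2 * δ) : ℝ) * Complex.exp (Complex.I * (-(t * δ / 2) : ℝ)) +
          ((δ - D) / (2 * δ) : ℝ) * Complex.exp (Complex.I * (t * δ / 2 : ℝ))) * f u := by
  classical
  have hδC : (δ : ℂ) ≠ 0 := Complex.ofReal_ne_zero.2 hδ
  have hδ2' : (δ : ℂ) ^ 2 = D ^ 2 + 4 * k * β ^ 2 := by exact_mod_cast hδ2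
  have hD' : (D : ℂ) = s + (Fintype.card V - 1) * (k - 1) := by rw [hD]; push_cast; rfl
  have hf' : ∀ x, (∑ y, if G.Adj x y then f x - f y else 0) = s * f x := fun x => by
    convert hf x
  -- The two eigenvalues are `(trace ± δ) / 2`, with eigenvectors `((D ± δ) / 2, β)`.
  have key (r : ℂ) (hr : r ^ 2 = (δ : ℂ) ^ 2) :
      ∑ a, lapTransition (vertexComplementedCorona G H) t (Sum.inl u) (Sum.inl a) *
          ((D + r) / 2 * f a) +
        ∑ y, lapTransition (vertexComplementedCorona G H) t (Sum.inl u) (Sum.inr y) *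
          (β * f y.1) =
      Complex.exp (-(Complex.I * t * ((s + (Fintype.card V - 1) * (1 + k) + r) / 2))) *
        ((D + r) / 2 * f u) := by
    have h := lapTransition_sum_of_eigenvector (vertexComplementedCorona G H) t
      (corona_eigenvector G H hW (p := (D + r) / 2) (q := β)
        (c := (s + (Fintype.card V - 1) * (1 + k) + r) / 2) hf' hβ ?_ ?_) (Sum.inl u)
    · rwa [Fintype.sum_sum_type] at h
    · rw [hδ2', hD'] at hr
      rw [hD']
      linear_combination (-1 / 4 : ℂ) * hr
    · rw [hD']
      ring
  have h1 := key δ rfl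
  have h2 := key (-δ) (by ring)
  have h3 : δ * ∑ a, lapTransition (vertexComplementedCorona G H) t (Sum.inl u) (Sum.inl a) * f a =
      ∑ a, lapTransition (vertexComplementedCorona G H) t (Sum.inl u) (Sum.inl a) *
          ((D + δ) / 2 * f a) -
      ∑ a, lapTransition (vertexComplementedCorona G H) t (Sum.inl u) (Sum.inl a) *
          ((D + -δ) / 2 * f a) := by
    rw [← Finset.sum_sub_distrib, Finset.mul_sum]
    refine Finset.sum_congr rfl fun a _ => by ring
  have e1 : Complex.exp (-(Complex.I * t * ((s + (Fintype.card V - 1) * (1 + k) + δ) / 2))) =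
      Complex.exp (-(Complex.I * t * ((s + (Fintype.card V - 1) * (1 + k) : ℝ) / 2))) *
        Complex.exp (Complex.I * (-(t * δ / 2) : ℝ)) := by
    rw [← Complex.exp_add]
    congr 1
    push_cast
    ring
  have e2 : Complex.exp (-(Complex.I * t * ((s + (Fintype.card V - 1) * (1 + k) + -δ) / 2))) =
      Complex.exp (-(Complex.I * t * ((s + (Fintype.card V - 1) * (1 + k) : ℝ) / 2))) *
        Complex.exp (Complex.I * (t * δ / 2 : ℝ)) := by
    rw [← Complex.exp_add]
    congr 1
    push_cast
    ring
  rw [e1] at h1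
  rw [e2] at h2
  apply mul_left_cancel₀ hδC
  have w1 : (δ : ℂ) * ((D + δ) / (2 * δ) : ℝ) = (D + δ) / 2 := by
    push_cast
    field_simp
  have w2 : (δ : ℂ) * ((δ - D) / (2 * δ) : ℝ) = (δ - D) / 2 := by
    push_cast
    field_simp
  generalize Complex.exp (Complex.I * (-(t * δ / 2) : ℝ)) = E₁ at h1 ⊢
  generalize Complex.exp (Complex.I * (t * δ / 2 : ℝ)) = E₂ at h2 ⊢
  generalize Complex.exp _ = E₀ at h1 h2 ⊢
  linear_combination h3 + h1 - h2 - (E₀ * E₁ * f u) * w1 - (E₀ * E₂ * f u) * w2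

/-- A convex combination of `exp (-i x)` and `exp (i x)` is close to `1` when `x` is close to
`2 π ℤ`. -/
theorem norm_convex_exp_sub_one_le {a b x : ℝ} (ha : 0 ≤ a) (hb : 0 ≤ b) (hab : a + b = 1)
    (m : ℤ) : ‖(a : ℂ) * Complex.exp (Complex.I * (-x : ℝ)) + b * Complex.exp (Complex.I * x) - 1‖
      ≤ |x - 2 * Real.pi * m| := by
  have h (y : ℝ) (l : ℤ) : ‖Complex.exp (Complex.I * y) - 1‖ ≤ |y - 2 * Real.pi * l| := by
    have : Complex.exp (Complex.I * y) =
        Complex.exp (Complex.I * (y - 2 * Real.pi * l : ℝ)) := by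
      rw [Complex.exp_eq_exp_iff_exists_int]
      exact ⟨l, by push_cast; ring⟩
    rw [this]
    exact Real.norm_exp_I_mul_ofReal_sub_one_le
  have hx := h x m
  have hx' := h (-x) (-m)
  have hneg : |-x - 2 * Real.pi * ((-m : ℤ) : ℝ)| = |x - 2 * Real.pi * m| := by
    rw [← abs_neg]
    congr 1
    push_cast
    ring
  rw [hneg] at hx'
  have hab' : (a : ℂ) + b = 1 := by exact_mod_cast hab
  calc _ = ‖(a : ℂ) * (Complex.exp (Complex.I * (-x : ℝ)) - 1)
        + b * (Complex.exp (Complex.I * x) - 1)‖ := by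
        congr 1
        linear_combination hab'
    _ ≤ a * ‖Complex.exp (Complex.I * (-x : ℝ)) - 1‖ + b * ‖Complex.exp (Complex.I * x) - 1‖ := by
        refine (norm_add_le _ _).trans ?_
        rw [norm_mul, norm_mul, Complex.norm_of_nonneg ha, Complex.norm_of_nonneg hb]
    _ ≤ a * |x - 2 * Real.pi * m| + b * |x - 2 * Real.pi * m| := by gcongr
    _ = _ := by rw [← add_mul, hab, one_mul]

end Corona

/-! ### State transfer in the vertex complemented corona -/

namespace LapEigenbasis

variable {V : Type*} [Fintype V] {G : SimpleGraph V} (B : LapEigenbasis G)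

/-- The number `β i` such that `J - I` acts on the eigenvector `vec i` of the Laplacian of a
connected graph as the scalar `-β i`, where `J` is the all-ones matrix. -/
noncomputable def complCoeff (i : V) : ℝ := if B.val i = 0 then -(Fintype.card V - 1) else 1

/-- The difference of the two eigenvalues of the Laplacian of the vertex complemented corona
arising from the eigenvector `vec i` of the Laplacian of `G`. -/
noncomputable def coronaGap (k : ℕ) (i : V) : ℝ :=
  √((B.val i + (Fintype.card V - 1) * (k - 1)) ^ 2 + 4 * k * B.complCoeff i ^ 2)

theorem sum_vec_sub_vec (hG : G.Connected) (i a : V) :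
    ∑ b, B.vec i b - B.vec i a = -B.complCoeff i * B.vec i a := by
  unfold complCoeff
  split_ifs with h
  · rw [Finset.sum_congr rfl fun b _ => B.vec_eq_of_val_eq_zero hG h b a, Finset.sum_const,
      Finset.card_univ, nsmul_eq_mul]
    ring
  · rw [B.sum_vec_eq_zero h]
    ring

theorem coronaGap_of_val_eq_zero {k : ℕ} (hn : 1 ≤ Fintype.card V) {i : V} (h : B.val i = 0) :
    B.coronaGap k i = ((Fintype.card V - 1) * (1 + k) : ℕ) := by
  have h0 : (0 : ℝ) ≤ (((Fintype.card V - 1) * (1 + k) : ℕ) : ℝ) := Nat.cast_nonneg _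
  rw [coronaGap, complCoeff, if_pos h, h, ← Real.sqrt_sq h0]
  congr 1
  push_cast [Nat.cast_sub hn]
  ring

theorem coronaGap_pos {k : ℕ} (hk : 1 ≤ k) (hn : 2 ≤ Fintype.card V) (i : V) :
    0 < B.coronaGap k i := by
  have hk' : (0 : ℝ) < k := by exact_mod_cast hk
  have hn' : (2 : ℝ) ≤ Fintype.card V := by exact_mod_cast hn
  have hβ : B.complCoeff i ≠ 0 := by
    unfold complCoeff
    split_ifs
    · intro h
      linarith
    · exact one_ne_zero
  apply Real.sqrt_pos.2
  positivity

theorem coronaGap_of_val_eq_natCast {k m : ℕ} (hk : 1 ≤ k) (hn : 1 ≤ Fintype.card V) {i : V}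
    (hm : B.val i = m) (hm0 : m ≠ 0) :
    B.coronaGap k i = √(((m + (Fintype.card V - 1) * (k - 1)) ^ 2 + 4 * k : ℕ) : ℝ) := by
  have h0 : B.val i ≠ 0 := by rw [hm]; exact_mod_cast hm0
  rw [coronaGap, complCoeff, if_neg h0, hm]
  congr 1
  push_cast [Nat.cast_sub hn, Nat.cast_sub hk]
  ring

/-- The scalar by which the transition matrix of the corona, compressed to the vertices of `G`,
acts on `vec i`. -/
noncomputable def coronaPhase (k : ℕ) (t : ℝ) (i : V) : ℂ :=
  Complex.exp (-(Complex.I * t * ((B.val i + (Fintype.card V - 1) * (1 + k) : ℝ) / 2))) *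
    (((B.val i + (Fintype.card V - 1) * (k - 1) + B.coronaGap k i) / (2 * B.coronaGap k i) : ℝ) *
        Complex.exp (Complex.I * (-(t * B.coronaGap k i / 2) : ℝ)) +
      ((B.coronaGap k i - (B.val i + (Fintype.card V - 1) * (k - 1))) / (2 * B.coronaGap k i) : ℝ) *
        Complex.exp (Complex.I * (t * B.coronaGap k i / 2 : ℝ)))

theorem coronaGap_sq (k : ℕ) (i : V) : B.coronaGap k i ^ 2 =
    (B.val i + (Fintype.card V - 1) * (k - 1)) ^ 2 + 4 * k * B.complCoeff i ^ 2 :=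
  Real.sq_sqrt (by positivity)

theorem lapTransition_corona_apply {W : V → Type*} [∀ v, Fintype (W v)] (hG : G.Connected)
    (H : ∀ v, SimpleGraph (W v)) {k : ℕ} (hk : 1 ≤ k) (hn : 2 ≤ Fintype.card V)
    (hW : ∀ v, Fintype.card (W v) = k) (t : ℝ) (u v : V) :
    lapTransition (vertexComplementedCorona G H) t (Sum.inl u) (Sum.inl v) =
      ∑ i, B.coronaPhase k t i * B.vec i u * B.vec i v := by
  classical
  rw [B.eq_sum_mul_vec
    (fun a => lapTransition (vertexComplementedCorona G H) t (Sum.inl u) (Sum.inl a)) v]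
  refine Finset.sum_congr rfl fun i _ => ?_
  congr 1
  refine lapTransition_corona_sum G H hW (f := fun a => (B.vec i a : ℂ)) (s := B.val i)
    (β := B.complCoeff i) (fun x => ?_) (fun a => ?_) rfl (B.coronaGap_pos hk hn i).ne'
    (B.coronaGap_sq k i) t u
  · have h := congrFun (B.mulVec_vec i) x
    rw [lapMatrix_mulVec_eq_sum, Pi.smul_apply, smul_eq_mul] at h
    have h2 := congrArg (fun r : ℝ => (r : ℂ)) h
    simp only [Complex.ofReal_sum, Complex.ofReal_mul] at h2
    rw [← h2]
    refine Finset.sum_congr rfl fun y _ => ?_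
    split_ifs <;> simp
  · exact_mod_cast B.sum_vec_sub_vec hG i a

/-- At the time `t = 2 π j / 2 ^ e` with `j` odd, the phase factor common to the two eigenvectors
arising from `vec i` is the phase of `vec i` in `G` at the time of perfect state transfer, so that
only the distance of `j * coronaGap / 2 ^ (e + 1)` to the integers matters. -/
theorem norm_coronaPhase_sub_le {k : ℕ} (hk : 1 ≤ k) (hn : 2 ≤ Fintype.card V) {e : ℕ}
    (hdvd : 2 ^ (e + 1) ∣ (Fintype.card V - 1) * (1 + k)) {τ : ℝ} {i : V} {m z : ℤ}
    (hm : B.val i = 2 ^ e * m) (hz : τ * B.val i = Real.pi * z) (hmz : Even (m - z)) (l p : ℤ) :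
    ‖B.coronaPhase k (2 * Real.pi * (2 * l + 1) / 2 ^ e) i
        - Complex.exp (-(Complex.I * τ * B.val i))‖ ≤
      2 * Real.pi * |(2 * l + 1) * (B.coronaGap k i / 2 ^ (e + 1)) - p| := by
  obtain ⟨M, hM⟩ := hdvd
  obtain ⟨r, hr⟩ := hmz
  have hδ := B.coronaGap_pos hk hn i
  have hD : |B.val i + (Fintype.card V - 1) * (k - 1)| ≤ B.coronaGap k i := by
    refine Real.abs_le_sqrt ?_
    have : 0 ≤ 4 * (k : ℝ) * B.complCoeff i ^ 2 := by positivity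
    linarith
  obtain ⟨hD1, hD2⟩ := abs_le.1 hD
  have h2e : (2 : ℝ) ^ e ≠ 0 := by positivity
  have hM' : ((Fintype.card V : ℝ) - 1) * (1 + k) = 2 ^ (e + 1) * M := by
    have := congrArg (Nat.cast (R := ℝ)) hM
    push_cast [Nat.cast_sub (show 1 ≤ Fintype.card V by omega)] at this
    exact this
  have hphase : Complex.exp (-(Complex.I * (2 * Real.pi * (2 * l + 1) / 2 ^ e : ℝ) *
      ((B.val i + (Fintype.card V - 1) * (1 + k) : ℝ) / 2))) =
      Complex.exp (-(Complex.I * τ * B.val i)) := by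
    rw [Complex.exp_eq_exp_iff_exists_int]
    refine ⟨-(l * m + (2 * l + 1) * M + r), ?_⟩
    have e1 : (2 * Real.pi * (2 * l + 1) / 2 ^ e : ℝ) *
        ((B.val i + (Fintype.card V - 1) * (1 + k)) / 2) =
        Real.pi * ((2 * l + 1) * (m + 2 * M)) := by
      rw [hM', hm, pow_succ]
      field_simp
    have e1' : ((2 * Real.pi * (2 * l + 1) / 2 ^ e : ℝ) : ℂ) *
        ((B.val i + (Fintype.card V - 1) * (1 + k) : ℝ) / 2) =
        Real.pi * ((2 * l + 1) * (m + 2 * M)) := by exact_mod_cast e1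
    have e2 : (τ : ℂ) * B.val i = Real.pi * z := by exact_mod_cast hz
    have e3 : (z : ℂ) = m - (r + r) := by
      have : z = m - (r + r) := by omega
      exact_mod_cast this
    rw [mul_assoc, e1', mul_assoc Complex.I, e2, e3]
    push_cast
    ring
  have hnorm : ‖Complex.exp (-(Complex.I * τ * B.val i))‖ = 1 := by
    simp [Complex.norm_exp]
  rw [coronaPhase, hphase, ← mul_sub_one, norm_mul, hnorm, one_mul]
  refine (norm_convex_exp_sub_one_le ?_ ?_ ?_ p).trans (le_of_eq ?_)
  · exact div_nonneg (by linarith) (by linarith)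
  · exact div_nonneg (by linarith) (by linarith)
  · field_simp
    ring
  · rw [← abs_of_pos Real.two_pi_pos, ← abs_mul, abs_of_pos Real.two_pi_pos]
    congr 1
    rw [pow_succ]
    field_simp

/-- Simultaneous approximation of the gaps. For eigenvalues `0` the gap is a multiple of
`2 ^ (e + 1)`; the others are square roots of nonsquare integers. -/
theorem exists_odd_mul_coronaGap_near_int {k : ℕ} (hk : 1 ≤ k) (hn : 2 ≤ Fintype.card V) {e : ℕ}
    (hdvd : 2 ^ (e + 1) ∣ (Fintype.card V - 1) * (1 + k)) {u : V}
    (hint : ∀ i, B.vec i u ≠ 0 → ∃ m : ℤ, B.val i = m) {ε : ℝ} (hε : 0 < ε) :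
    ∃ l : ℤ, ∀ i, B.vec i u ≠ 0 →
      ∃ p : ℤ, |(2 * l + 1) * (B.coronaGap k i / 2 ^ (e + 1)) - p| < ε := by
  classical
  have hnat : ∀ i, ∃ m : ℕ, B.vec i u ≠ 0 → B.val i = m := fun i => by
    by_cases hi : B.vec i u = 0
    · exact ⟨0, fun h => absurd hi h⟩
    · obtain ⟨m, hm⟩ := hint i hi
      have h0 : 0 ≤ m := by
        have := B.val_nonneg i
        rw [hm] at this
        exact_mod_cast this
      lift m to ℕ using h0
      exact ⟨m, fun _ => by exact_mod_cast hm⟩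
  choose m hm using hnat
  -- The vanishing radicand stands for the indices that do not need the approximation.
  let D (i : V) : ℕ :=
    if m i = 0 then 0 else (m i + (Fintype.card V - 1) * (k - 1)) ^ 2 + 4 * k
  have hD (i : V) : D i = 0 ∨ ¬ IsSquare (D i) := by
    by_cases h : m i = 0
    · exact Or.inl (if_pos h)
    · right
      simp only [D, if_neg h]
      refine not_isSquare_sq_add_four_mul _ _ hk ?_
      have : k - 1 ≤ (Fintype.card V - 1) * (k - 1) := Nat.le_mul_of_pos_left _ (by omega)
      omega
  have h2e : (2 : ℝ) ^ (e + 1) ≠ 0 := by positivity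
  obtain ⟨l, hl⟩ := exists_odd_mul_near_int (fun i => √(D i : ℝ) / 2 ^ (e + 1)) (fun c r hr => by
    have h1 : ∑ i, c i * √(D i : ℝ) = ((2 ^ e * (2 * r + 1) : ℚ) : ℝ) := by
      simp_rw [← mul_div_assoc] at hr
      rw [← Finset.sum_div, div_eq_iff h2e] at hr
      rw [hr, pow_succ]
      push_cast
      ring
    have h2 := sum_sqrt_eq_zero_of_rational D hD c _ h1
    have h3 : (2 * r + 1 : ℚ) = 0 := (mul_eq_zero.1 h2).resolve_left (by positivity)
    have h4 : 2 * r + 1 = 0 := by exact_mod_cast h3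
    omega) ε hε
  refine ⟨l, fun i hi => ?_⟩
  by_cases h0 : m i = 0
  · obtain ⟨M, hM⟩ := hdvd
    refine ⟨(2 * l + 1) * M, ?_⟩
    rw [B.coronaGap_of_val_eq_zero (by omega) (by rw [hm i hi, h0, Nat.cast_zero]), hM]
    push_cast
    rw [mul_div_cancel_left₀ _ h2e, sub_self, abs_zero]
    exact hε
  · obtain ⟨p, hp⟩ := hl i
    refine ⟨p, ?_⟩
    rw [B.coronaGap_of_val_eq_natCast hk (by omega) (hm i hi) h0]
    simpa only [D, if_neg h0] using hp

end LapEigenbasis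

theorem theorem5p1 {V : Type*} [Fintype V] {W : V → Type*} [∀ v, Fintype (W v)]
    (G : SimpleGraph V) (hG : G.Connected) (H : ∀ v, SimpleGraph (W v))
    (k : ℕ) (hk : 1 ≤ k) (hW : ∀ v, Fintype.card (W v) = k)
    (u v : V) (huv : HasLPST G u v) :
    ∃ e : ℕ, IsGreatest {m : ℕ | TwoPowDividesAll (lapSupport G u) m} e ∧
      (2 ^ (e + 1) ∣ (Fintype.card V - 1) * (1 + k) →
        HasLPGST (vertexComplementedCorona G H) (Sum.inl u) (Sum.inl v)) := by
  classical
  obtain ⟨hne, τ, hτ⟩ := huv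
  obtain ⟨B⟩ := LapEigenbasis.nonempty G
  have hphase := B.exp_mul_vec_eq_of_norm_eq_one hτ
  obtain ⟨hz, hodd⟩ := B.exists_int_phase hne hphase
  have hnz : ∃ i, B.vec i u ≠ 0 ∧ τ * B.val i ≠ 0 := by
    obtain ⟨i, hi, z, hzodd, hzi⟩ := hodd
    refine ⟨i, hi, hzi ▸ mul_ne_zero Real.pi_ne_zero (Int.cast_ne_zero.2 ?_)⟩
    rintro rfl
    simp at hzodd
  have hint : ∀ i, B.vec i u ≠ 0 → ∃ m : ℤ, B.val i = m :=
    fun i hi => B.exists_int_of_commensurable hz hnz hi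
  obtain ⟨e, he⟩ := B.exists_isGreatest_twoPow hint
    (hnz.imp fun i h => ⟨h.1, right_ne_zero_of_mul h.2⟩)
  refine ⟨e, he, fun hdvd ε hε => ?_⟩
  have hn : 2 ≤ Fintype.card V := Fintype.one_lt_card_iff.2 ⟨u, v, hne⟩
  set C : ℝ := ∑ i, |B.vec i u| * |B.vec i v| with hC
  have hC0 : 0 ≤ C := Finset.sum_nonneg fun i _ => by positivity
  have hpi := Real.pi_pos
  set η : ℝ := ε / (2 * Real.pi * (C + 1)) with hη
  obtain ⟨l, hl⟩ := B.exists_odd_mul_coronaGap_near_int hk hn hdvd hint (ε := η) (by positivity)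
  set t : ℝ := 2 * Real.pi * (2 * l + 1) / 2 ^ e with ht
  refine ⟨t, ?_⟩
  have hclose : ‖lapTransition (vertexComplementedCorona G H) t (Sum.inl u) (Sum.inl v) - 1‖
      ≤ ε := by
    have hone : (1 : ℂ) = ∑ i, Complex.exp (-(Complex.I * τ * B.val i)) * B.vec i u * B.vec i v := by
      simp_rw [hphase, ← Complex.ofReal_mul]
      rw [← Complex.ofReal_sum, B.sum_vec_apply, if_pos rfl, Complex.ofReal_one]
    rw [B.lapTransition_corona_apply hG H hk hn hW, hone, ← Finset.sum_sub_distrib]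
    calc _ ≤ ∑ i, 2 * Real.pi * η * (|B.vec i u| * |B.vec i v|) := by
          refine norm_sum_le_of_le _ fun i _ => ?_
          rw [← sub_mul, ← sub_mul, norm_mul, norm_mul, Complex.norm_real, Complex.norm_real,
            Real.norm_eq_abs, Real.norm_eq_abs, mul_assoc]
          by_cases hi : B.vec i u = 0
          · simp [hi]
          · obtain ⟨p, hp⟩ := hl i hi
            obtain ⟨m, z, hm, hzi, hmz⟩ := B.even_sub_of_isGreatest he hodd hz hi
            refine mul_le_mul_of_nonneg_right ?_ (by positivity)
            refine (B.norm_coronaPhase_sub_le hk hn hdvd hm hzi hmz l p).trans ?_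
            exact mul_le_mul_of_nonneg_left hp.le (by positivity)
      _ = ε * (C / (C + 1)) := by
          rw [← Finset.mul_sum, ← hC, hη]
          field_simp
      _ ≤ ε := by
          refine mul_le_of_le_one_right hε.le ?_
          rw [div_le_one (by positivity)]
          linarith
  have h := norm_sub_norm_le (1 : ℂ)
    (lapTransition (vertexComplementedCorona G H) t (Sum.inl u) (Sum.inl v))
  rw [norm_one, norm_sub_rev] at h
  linarith
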